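/- All graphs are finite and simple. For a graph $G$, the TARS-graph $\varepsilon(G)$ is the graph whose vertices are the dominating sets of $G$ (the sets $D\subseteq V(G)$ such that every vertex of $V(G)\setminus D$ is adjacent to a vertex of $D$), where two dominating sets $X$ and $Y$ are adjacent if and only if either $Y$ is obtained from $X$ by adding or deleting a single vertex of $G$, or there are vertices $a\in X$ and $b\in Y\setminus X$, adjacent in $G$, such that $Y=(X\cup\{b\})\setminus\{a\}$. A graph on $n$ vertices is pancyclic if it contains a cycle of length $\ell$ for every integer $\ell$ with $3\le \ell\le n$. A graph $H'$ is obtained from a graph $H$ by Operation A if $H$ has distinct vertices $u,v,x$ with $N(u)=\{x,v\}$ and $N(v)=\{u\}$, and $H'=H-\{u,v\}$ (up to isomorphism). Theorem. Let $H'$ be a connected graph on at least $2$ vertices that is obtained from a graph $H$ by Operation A. If $\varepsilon(H')$ is pancyclic, then $\varepsilon(H)$ is pancyclic. -/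

import Mathlib

namespace SimpleGraph

/-- `D` is a dominating set of `G`: every vertex outside `D` is adjacent to some vertex of `D`. -/
def IsDominatingSet {V : Type*} (G : SimpleGraph V) (D : Set V) : Prop :=
  ∀ w, w ∉ D → ∃ d ∈ D, G.Adj w d

/-- Token addition/removal: `Y` is obtained from `X` by adding a vertex that is not in `X`, or by
deleting a vertex of `X`. -/
def TokenAddRemove {V : Type*} (X Y : Set V) : Prop :=
  (∃ w, w ∉ X ∧ Y = X ∪ {w}) ∨ (∃ w, w ∈ X ∧ Y = X \ {w})

/-- Token sliding: `Y` is obtained from `X` by exchanging some `u ∈ X` for a vertex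
`v ∈ Y \ X` adjacent to `u` in `G`. -/
def TokenSlide {V : Type*} (G : SimpleGraph V) (X Y : Set V) : Prop :=
  ∃ u v, u ∈ X ∧ v ∈ Y \ X ∧ G.Adj u v ∧ Y = (X ∪ {v}) \ {u}

theorem TokenAddRemove.symm {V : Type*} {X Y : Set V} (h : TokenAddRemove X Y) :
    TokenAddRemove Y X := by
  rcases h with ⟨w, hw, rfl⟩ | ⟨w, hw, rfl⟩
  · refine Or.inr ⟨w, by simp, ?_⟩
    ext z
    by_cases hz : z = w <;> simp_all
  · refine Or.inl ⟨w, by simp, ?_⟩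
    ext z
    by_cases hz : z = w <;> simp_all

theorem TokenAddRemove.ne {V : Type*} {X Y : Set V} (h : TokenAddRemove X Y) : X ≠ Y := by
  rintro rfl
  rcases h with ⟨w, hw, h⟩ | ⟨w, hw, h⟩
  · exact hw (h ▸ Or.inr rfl)
  · rw [h] at hw
    exact hw.2 rfl

theorem TokenSlide.symm {V : Type*} {G : SimpleGraph V} {X Y : Set V} (h : G.TokenSlide X Y) :
    G.TokenSlide Y X := by
  obtain ⟨u, v, hu, ⟨hv, hvX⟩, huv, rfl⟩ := h
  refine ⟨v, u, hv, ⟨hu, fun hu' => hu'.2 rfl⟩, huv.symm, ?_⟩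
  have hne := huv.ne
  ext z
  by_cases hz : z = u <;> by_cases hz' : z = v <;> simp_all

theorem TokenSlide.ne {V : Type*} {G : SimpleGraph V} {X Y : Set V} (h : G.TokenSlide X Y) :
    X ≠ Y := by
  rintro rfl
  obtain ⟨u, v, hu, hv, -⟩ := h
  exact hv.2 hv.1

/-- The TARS-graph of the seed graph `G`: its vertices are the dominating sets of `G`, and two of
them are adjacent if one is obtained from the other by token addition/removal or by token
sliding. -/
def tarsGraph {V : Type*} (G : SimpleGraph V) : SimpleGraph {D : Set V // G.IsDominatingSet D} where
  Adj X Y := TokenAddRemove X.1 Y.1 ∨ G.TokenSlide X.1 Y.1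
  symm := ⟨fun _ _ h => h.imp TokenAddRemove.symm TokenSlide.symm⟩
  loopless := ⟨fun _ h => h.elim (fun h => h.ne rfl) (fun h => h.ne rfl)⟩

/-- A finite graph on `n` vertices is pancyclic if it has a cycle of length `l` for every integer
`l` with `3 ≤ l ≤ n`. -/
def IsPancyclic {V : Type*} [Finite V] (G : SimpleGraph V) : Prop :=
  ∀ l : ℕ, 3 ≤ l → l ≤ Nat.card V → ∃ (a : V) (p : G.Walk a a), p.IsCycle ∧ p.length = l

/-- `H'` is obtained from `H` by Operation A: `H` has distinct vertices `u`, `v`, `x` with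
`N(u) = {x, v}` and `N(v) = {u}`, and `H'` is (a copy of) `H - {u, v}`. -/
def IsOperationA {V W : Type*} (H : SimpleGraph V) (H' : SimpleGraph W) : Prop :=
  ∃ u v x : V, x ≠ v ∧ H.neighborSet u = {x, v} ∧ H.neighborSet v = {u} ∧
    Nonempty (H' ≃g H.induce ({u, v}ᶜ : Set V))

end SimpleGraph

namespace SimpleGraph

/-! Every dominating set of `H` is a trace `E` on `H'` together with a nonempty part of `{u, v}`. If
`E` dominates `H'`, all three parts are allowed and form a triangle. Otherwise `E` misses only `x`,
the part must contain `u`, and `E ∪ {x}` is a critical dominating set. So the TARS-graph of `H` has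
a spanning subgraph built from that of `H'`: triangles over its vertices, plus an extra edge over
each critical one (`IsPendantPath.isExpansion`). Only a Hamiltonian cycle of the TARS-graph of `H'`,
on `n` vertices, is needed. A path with `k` vertices, walked out in the layers `some s` and back in
the layer `none`, gives cycles of lengths `2k` to `3k`, hence every length up to `3n`. Replacing a
rung by a detour through an extra edge adds 2. For an odd excess over `3n`, the path starts at a
critical vertex, and one endpoint of its extra edge is inserted at the closing edge
(`IsExpansion.isPancyclic`). -/

/-! ### Cycles and Hamiltonian paths as lists. -/

/-- A duplicate-free list of at least three vertices whose consecutive entries are adjacent, also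
cyclically, is traversed by a cycle. -/
theorem exists_isCycle_of_isChain {T : Type*} {G : SimpleGraph T} {l : List T}
    (hchain : l.IsChain G.Adj) (hnodup : l.Nodup) (hlen : 3 ≤ l.length) {a b : T}
    (ha : l.head? = some a) (hb : l.getLast? = some b) (hba : G.Adj b a) :
    ∃ (c : T) (p : G.Walk c c), p.IsCycle ∧ p.length = l.length := by
  have hne : l ≠ [] := by rintro rfl; simp at hlen
  obtain rfl : l.head hne = a := by simpa [List.head?_eq_some_head hne] using ha
  obtain rfl : l.getLast hne = b := by simpa [List.getLast?_eq_some_getLast hne] using hb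
  have hp : (Walk.ofSupport l hne hchain).IsPath := by
    rw [Walk.isPath_def, Walk.support_ofSupport]; exact hnodup
  have hlen' := Walk.length_ofSupport hne hchain
  refine ⟨_, Walk.cons hba (Walk.ofSupport l hne hchain), ?_, ?_⟩
  · rw [Walk.cons_isCycle_iff]
    refine ⟨hp, fun h => ?_⟩
    rw [Sym2.eq_swap] at h
    have := hp.length_eq_one_of_mem_edges h
    omega
  · rw [Walk.length_cons]; omega

/-- A graph with a Hamiltonian cycle, given as a cycle whose length is the number of vertices, has
a Hamiltonian path starting at any vertex. -/
theorem Walk.IsCycle.exists_hamiltonian_list {A : Type*} [Finite A] {G : SimpleGraph A} {a : A}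
    {p : G.Walk a a} (hp : p.IsCycle) (hlen : p.length = Nat.card A) (c : A) :
    ∃ l : List A, (c :: l).IsChain G.Adj ∧ (c :: l).Nodup ∧ ∀ x, x ∈ c :: l := by
  classical
  have := Fintype.ofFinite A
  have all : ∀ {l : List A}, l.Nodup → l.length = Nat.card A → ∀ x, x ∈ l := by
    intro l hl hcard x
    have : l.toFinset = Finset.univ := by
      rw [← Finset.card_eq_iff_eq_univ, List.toFinset_card_of_nodup hl, hcard,
        Nat.card_eq_fintype_card]
    simpa using this.ge (Finset.mem_univ x)
  have hc : c ∈ p.support :=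
    List.mem_of_mem_tail (all hp.support_nodup (by simp [hlen]) c)
  have hq := hp.rotate hc
  have hql : (p.rotate c hc).length = Nat.card A := by rw [Walk.length_rotate, hlen]
  generalize p.rotate c hc = q at hq hql
  cases q with
  | nil => simp at hq
  | cons h q =>
    rw [Walk.cons_isCycle_iff] at hq
    -- Dropping the first edge leaves a path ending at `c`; its reverse starts there.
    have hr := hq.1.reverse
    have hrl : q.reverse.support.length = Nat.card A := by simpa using hql
    have hch := q.reverse.isChain_adj_support
    rw [Walk.isPath_def] at hr
    have hall := all hr hrl
    rw [← Walk.cons_tail_support] at hch hr hall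
    exact ⟨_, hch, hr, hall⟩

/-! ### Expansions and their cycles. -/

/-- The vertices of the graph obtained from a graph on `A` by replacing each vertex by a triangle
and by attaching an edge to the triangles over `S`. -/
abbrev Expansion {A : Type*} (S : Set A) : Type _ := (A × Option Bool) ⊕ (S × Bool)

/-- The vertex of `A` over which a vertex of the expansion lies. -/
def Expansion.base {A : Type*} {S : Set A} : Expansion S → A :=
  Sum.elim (fun m => m.1) (fun m => m.1)

/-- Adjacencies that make `M` a spanning supergraph of the expansion of `G`: the product of `G`
with a triangle on `Option Bool`, and for each vertex of `S` an additional edge. -/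
structure IsExpansion {A : Type*} (G : SimpleGraph A) (S : Set A)
    (M : SimpleGraph (Expansion S)) : Prop where
  rung : ∀ c s, M.Adj (.inl (c, some s)) (.inl (c, some !s))
  layer : ∀ k c c', G.Adj c c' → M.Adj (.inl (c, k)) (.inl (c', k))
  top : ∀ c s, M.Adj (.inl (c, some s)) (.inl (c, none))
  outer_rung : ∀ c s, M.Adj (.inr (c, s)) (.inr (c, !s))
  outer : ∀ (c : S) s, M.Adj (.inl (c.1, some s)) (.inr (c, s))
  outer_top : ∀ c : S, M.Adj (.inr (c, true)) (.inl (c.1, none))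

/-- `z` is a path over the list `l` that starts in the layer `s` over the first entry of `l`
and ends in the layer `none` over the same entry. -/
structure IsLoopPath {A : Type*} {S : Set A} (M : SimpleGraph (Expansion S)) (s : Bool)
    (l : List A) (z : List (Expansion S)) : Prop where
  chain : z.IsChain M.Adj
  nodup : z.Nodup
  base_mem : ∀ m ∈ z, m.base ∈ l
  head : ∀ c ∈ l.head?, z.head? = some (.inl (c, some s))
  last : ∀ c ∈ l.head?, z.getLast? = some (.inl (c, none))

namespace IsLoopPath

variable {A : Type*} {G : SimpleGraph A} {S : Set A} {M : SimpleGraph (Expansion S)}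

theorem nil (s : Bool) : IsLoopPath M s [] [] where
  chain := .nil
  nodup := .nil
  base_mem := by simp
  head := by simp
  last := by simp

/-- Prolong a loop path by a block over a new vertex `c`, which leads from layer `s` to layer
`s'`. -/
theorem cons (hM : IsExpansion G S M) {s s' : Bool} {c : A} {l : List A}
    {z B : List (Expansion S)} (hz : IsLoopPath M s' l z) (hl : (c :: l).IsChain G.Adj)
    (hc : (c :: l).Nodup) (hchain : B.IsChain M.Adj) (hnodup : B.Nodup)
    (hbase : ∀ m ∈ B, m.base = c) (htop : .inl (c, none) ∉ B)
    (hhead : B.head? = some (.inl (c, some s)))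
    (hlast : B.getLast? = some (.inl (c, some s'))) :
    IsLoopPath M s (c :: l) (B ++ (z ++ [.inl (c, none)])) where
  chain := by
    cases l with
    | nil =>
      -- Over the empty list the endpoint conditions are vacuous, but `base_mem` forces `z` to be
      -- empty, so the block closes up by a triangle edge.
      obtain rfl : z = [] := List.eq_nil_iff_forall_not_mem.2 fun m hm => by
        simpa using hz.base_mem m hm
      simpa [List.isChain_append, hchain, hlast] using hM.top c s'
    | cons d l =>
      have hcd : G.Adj c d := by simpa using hl.rel
      have h1 := hz.head d (by simp)
      have h2 := hz.last d (by simp)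
      have hne : z ≠ [] := by rintro rfl; simp at h1
      simp [List.isChain_append, hchain, hz.chain, h2, hlast, List.head?_append, h1,
        hM.layer _ _ _ hcd, hM.layer _ _ _ hcd.symm]
  nodup := by
    have hc' := (List.nodup_cons.1 hc).1
    have hz' : ∀ m ∈ z, m.base ≠ c := fun m hm h => hc' (h ▸ hz.base_mem m hm)
    have htz : .inl (c, none) ∉ z := fun h => hz' _ h rfl
    simp only [List.nodup_append, hnodup, hz.nodup, true_and]
    refine ⟨⟨by simp, fun a ha b hb h => ?_⟩, fun a ha b hb h => ?_⟩
    · simp only [List.mem_singleton] at hb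
      exact htz (hb ▸ h ▸ ha)
    · subst h
      rcases List.mem_append.1 hb with hb | hb
      · exact hz' a hb (hbase a ha)
      · simp only [List.mem_singleton] at hb
        exact htop (hb ▸ ha)
  base_mem := by
    intro m hm
    simp only [List.mem_append, List.mem_singleton] at hm
    rcases hm with hm | hm | rfl
    · simp [hbase m hm]
    · exact List.mem_cons_of_mem _ (hz.base_mem m hm)
    · simp [Expansion.base]
  head := by simp [List.head?_append, hhead]
  last := by simp

theorem cons_single (hM : IsExpansion G S M) {s : Bool} {c : A} {l : List A}
    {z : List (Expansion S)} (hz : IsLoopPath M s l z) (hl : (c :: l).IsChain G.Adj)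
    (hc : (c :: l).Nodup) :
    IsLoopPath M s (c :: l) ([.inl (c, some s)] ++ (z ++ [.inl (c, none)])) :=
  hz.cons hM hl hc (by simp) (by simp) (by simp [Expansion.base]) (by simp) rfl rfl

theorem cons_rung (hM : IsExpansion G S M) {s : Bool} {c : A} {l : List A}
    {z : List (Expansion S)} (hz : IsLoopPath M (!s) l z) (hl : (c :: l).IsChain G.Adj)
    (hc : (c :: l).Nodup) :
    IsLoopPath M s (c :: l)
      ([.inl (c, some s), .inl (c, some !s)] ++ (z ++ [.inl (c, none)])) :=
  hz.cons hM hl hc (by simpa using hM.rung c s) (by simp) (by simp [Expansion.base]) (by simp)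
    rfl rfl

/-- The detour has the same ends as the rung, so it can replace the rung at the cost of two more
vertices. -/
theorem cons_outer (hM : IsExpansion G S M) {s : Bool} {c : A} {l : List A}
    {z : List (Expansion S)} (hz : IsLoopPath M (!s) l z) (hl : (c :: l).IsChain G.Adj)
    (hc : (c :: l).Nodup) (hS : c ∈ S) :
    IsLoopPath M s (c :: l)
      ([.inl (c, some s), .inr (⟨c, hS⟩, s), .inr (⟨c, hS⟩, !s), .inl (c, some !s)] ++
        (z ++ [.inl (c, none)])) :=
  hz.cons hM hl hc
    (by simpa using ⟨hM.outer ⟨c, hS⟩ s, hM.outer_rung ⟨c, hS⟩ s, (hM.outer ⟨c, hS⟩ !s).symm⟩)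
    (by simp) (by simp [Expansion.base]) (by simp) rfl rfl

/-- A path with `k` vertices lifts to loop paths with `2k`, ..., `3k` vertices. -/
theorem exists_short (hM : IsExpansion G S M) (l : List A) (hl : l.IsChain G.Adj)
    (hc : l.Nodup) (n : ℕ) (hn : n ≤ l.length) (s : Bool) :
    ∃ z, IsLoopPath M s l z ∧ z.length = 2 * l.length + n := by
  induction l generalizing n s with
  | nil => exact ⟨[], nil s, by simpa [eq_comm] using hn⟩
  | cons c l ih =>
    have hc' := (List.nodup_cons.1 hc).2
    rcases n with _ | n
    · obtain ⟨z, hz, hlen⟩ := ih hl.tail hc' 0 (by simp) s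
      exact ⟨_, hz.cons_single hM hl hc, by simp; omega⟩
    · obtain ⟨z, hz, hlen⟩ := ih hl.tail hc' n (by simpa using hn) (!s)
      exact ⟨_, hz.cons_rung hM hl hc, by simp; omega⟩

/-- A path with `k` vertices lifts to loop paths with `3k + 2n` vertices, if at least `n` vertices
of the path are in `S`. -/
theorem exists_long (hM : IsExpansion G S M) [DecidablePred (· ∈ S)] (l : List A)
    (hl : l.IsChain G.Adj) (hc : l.Nodup) (n : ℕ) (hn : n ≤ l.countP (· ∈ S)) (s : Bool) :
    ∃ z, IsLoopPath M s l z ∧ z.length = 3 * l.length + 2 * n := by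
  induction l generalizing n s with
  | nil => exact ⟨[], nil s, by simpa [eq_comm] using hn⟩
  | cons c l ih =>
    have hc' := (List.nodup_cons.1 hc).2
    -- Detours are made as late as possible: `c` takes one only if the tail cannot accommodate all
    -- `n`.
    by_cases h : n ≤ l.countP (· ∈ S)
    · obtain ⟨z, hz, hlen⟩ := ih hl.tail hc' n h (!s)
      exact ⟨_, hz.cons_rung hM hl hc, by simp; omega⟩
    · by_cases hS : c ∈ S
      · rw [List.countP_cons_of_pos (by simpa using hS)] at hn
        obtain ⟨z, hz, hlen⟩ := ih hl.tail hc' (n - 1) (by omega) (!s)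
        exact ⟨_, hz.cons_outer hM hl hc hS, by simp; omega⟩
      · rw [List.countP_cons_of_neg (by simpa using hS)] at hn
        exact absurd hn h

end IsLoopPath

variable {A : Type*} {G : SimpleGraph A} {S : Set A} {M : SimpleGraph (Expansion S)}

theorem IsLoopPath.exists_isCycle (hM : IsExpansion G S M) {s : Bool} {c : A} {l : List A}
    {z : List (Expansion S)} (hz : IsLoopPath M s (c :: l) z) (hlen : 3 ≤ z.length) :
    ∃ (a : Expansion S) (p : M.Walk a a), p.IsCycle ∧ p.length = z.length :=
  exists_isCycle_of_isChain hz.chain hz.nodup hlen (hz.head c rfl) (hz.last c rfl)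
    (hM.top c s).symm

/-- If `G` has a Hamiltonian cycle, then its expansions are pancyclic. -/
theorem IsExpansion.isPancyclic [Finite A] (hM : IsExpansion G S M) {a : A} {p : G.Walk a a}
    (hp : p.IsCycle) (hlen : p.length = Nat.card A) : M.IsPancyclic := by
  classical
  have := Fintype.ofFinite A
  intro L h3 hL
  have hcard : Nat.card (Expansion S) = 3 * Nat.card A + 2 * Nat.card S := by
    simp; ring
  rw [hcard] at hL
  have length_eq : ∀ {l : List A}, l.Nodup → (∀ x, x ∈ l) → l.length = Nat.card A := by
    intro l hl hall
    rw [← List.toFinset_card_of_nodup hl, Nat.card_eq_fintype_card,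
      Finset.card_eq_iff_eq_univ, Finset.eq_univ_iff_forall]
    simpa using hall
  have countP_eq : ∀ {l : List A}, l.Nodup → (∀ x, x ∈ l) →
      l.countP (· ∈ S) = Nat.card S := by
    intro l hl hall
    rw [List.countP_eq_length_filter, ← List.toFinset_card_of_nodup (hl.filter _),
      Nat.card_eq_fintype_card, ← Set.toFinset_card]
    congr 1
    ext x
    simp [hall x]
  by_cases hlong : L ≤ 3 * Nat.card A
  · obtain ⟨l, hl, hnd, hall⟩ := hp.exists_hamiltonian_list hlen a
    have hll := length_eq hnd hall
    -- Up to `2 * Nat.card A` a prefix with at most one rung suffices; beyond that, the whole path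
    -- with enough rungs.
    obtain ⟨k, n, hk0, hk, hn, rfl⟩ : ∃ k n, 1 ≤ k ∧ k ≤ Nat.card A ∧ n ≤ k ∧ 2 * k + n = L := by
      by_cases h : L ≤ 2 * Nat.card A
      · exact ⟨L / 2, L % 2, by omega, by omega, by omega, by omega⟩
      · exact ⟨Nat.card A, L - 2 * Nat.card A, by omega, le_rfl, by omega, by omega⟩
    obtain ⟨k, rfl⟩ := Nat.exists_eq_add_of_le' hk0
    have hlen' : ((a :: l).take (k + 1)).length = k + 1 := by
      rw [List.length_take]; omega
    obtain ⟨z, hz, hzl⟩ := IsLoopPath.exists_short hM ((a :: l).take (k + 1)) (hl.take _)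
      (hnd.sublist (List.take_sublist _ _)) n (by omega) true
    rw [hlen'] at hzl
    rw [List.take_succ_cons] at hz
    rw [← hzl] at h3 ⊢
    exact hz.exists_isCycle hM h3
  · by_cases hpar : (L - 3 * Nat.card A) % 2 = 0
    · obtain ⟨l, hl, hnd, hall⟩ := hp.exists_hamiltonian_list hlen a
      obtain ⟨z, hz, hzl⟩ := IsLoopPath.exists_long hM _ hl hnd
        ((L - 3 * Nat.card A) / 2) (by rw [countP_eq hnd hall]; omega) true
      rw [length_eq hnd hall] at hzl
      obtain rfl : z.length = L := by omega
      exact hz.exists_isCycle hM h3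
    · obtain ⟨⟨c, hc⟩⟩ : Nonempty S := by
        by_contra h
        have : IsEmpty S := not_nonempty_iff.1 h
        rw [Nat.card_of_isEmpty (α := S)] at hL
        omega
      obtain ⟨l, hl, hnd, hall⟩ := hp.exists_hamiltonian_list hlen c
      have hcount := countP_eq hnd hall
      rw [List.countP_cons_of_pos (by simpa using hc)] at hcount
      have hll := length_eq hnd hall
      rw [List.length_cons] at hll
      obtain ⟨z, hz, hzl⟩ := IsLoopPath.exists_long hM _ hl.tail (List.nodup_cons.1 hnd).2
        ((L - 3 * Nat.card A) / 2) (by rw [List.tail_cons]; omega) (!true)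
      rw [List.tail_cons] at hz hzl
      -- The start must be in layer `true`, because `outer_top` joins only the outer vertex `true`
      -- to the layer `none`.
      have hy := hz.cons_rung hM hl hnd
      generalize hyz : [Sum.inl (c, some true), .inl (c, some !true)] ++
        (z ++ [.inl (c, none)]) = y at hy
      have hyl : y.length = z.length + 3 := by rw [← hyz]; simp
      have hq : Sum.inr (⟨c, hc⟩, true) ∉ y := by
        have : Sum.inr (⟨c, hc⟩, true) ∉ z := fun h =>
          (List.nodup_cons.1 hnd).1 (hz.base_mem _ h)
        rw [← hyz]; simpa using this
      have hLlen : (y ++ [(.inr (⟨c, hc⟩, true) : Expansion S)]).length = L := by simp; omega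
      rw [← hLlen] at h3 ⊢
      refine exists_isCycle_of_isChain ?_ ?_ h3 (a := .inl (c, some true))
        (b := .inr (⟨c, hc⟩, true)) ?_ (by simp) (hM.outer ⟨c, hc⟩ true).symm
      · simpa [List.isChain_append, hy.chain, hy.last c rfl] using (hM.outer_top ⟨c, hc⟩).symm
      · rw [List.nodup_append]
        refine ⟨hy.nodup, by simp, fun m hm b hb h => ?_⟩
        rw [List.mem_singleton] at hb
        exact hq (hb ▸ h ▸ hm)
      · simp [List.head?_append, hy.head c rfl]


/-! ### Transfer to the TARS-graph, and dominating sets after attaching a path. -/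

/-- Pancyclicity passes along a bijective homomorphism. -/
theorem IsPancyclic.of_bijective {A B : Type*} [Finite A] [Finite B] {G : SimpleGraph A}
    {M : SimpleGraph B} (f : G →g M) (hf : Function.Bijective f) (hG : G.IsPancyclic) :
    M.IsPancyclic := by
  intro l h3 hl
  rw [← Nat.card_eq_of_bijective f hf] at hl
  obtain ⟨a, p, hp, rfl⟩ := hG l h3 hl
  exact ⟨_, p.map f, hp.map hf.injective, p.length_map f⟩

/-- `H` arises from the graph `H'`, embedded by `j`, by attaching the path `x - u - v`
at the vertex `x`. -/
structure IsPendantPath {V W : Type*} (H : SimpleGraph V) (H' : SimpleGraph W) (j : W → V)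
    (u v : V) (x : W) : Prop where
  injective : Function.Injective j
  cases : ∀ y, y = u ∨ y = v ∨ ∃ w, y = j w
  ne_u : ∀ w, j w ≠ u
  ne_v : ∀ w, j w ≠ v
  u_ne_v : u ≠ v
  adj_iff : ∀ w w', H.Adj (j w) (j w') ↔ H'.Adj w w'
  adj_u : ∀ w, H.Adj (j w) u ↔ w = x
  adj_uv : H.Adj u v
  not_adj_v : ∀ w, ¬ H.Adj (j w) v

theorem IsOperationA.exists_isPendantPath {V W : Type*} {H : SimpleGraph V} {H' : SimpleGraph W}
    (h : H.IsOperationA H') : ∃ j u v x, IsPendantPath H H' j u v x := by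
  obtain ⟨u, v, x, hxv, hu, hv, ⟨e⟩⟩ := h
  have hu' : ∀ y, H.Adj u y ↔ y = x ∨ y = v := fun y => by
    simpa using Set.ext_iff.1 hu y
  have hv' : ∀ y, H.Adj v y ↔ y = u := fun y => by
    simpa using Set.ext_iff.1 hv y
  have hxu : x ≠ u := fun h => H.irrefl ((hu' u).2 (Or.inl h.symm))
  have hmem : ∀ w, (e w : V) ≠ u ∧ (e w : V) ≠ v := fun w => by
    simpa only [Set.mem_compl_iff, Set.mem_insert_iff, Set.mem_singleton_iff, not_or] using (e w).2
  have hsurj : ∀ y, y = u ∨ y = v ∨ ∃ w, y = (e w : V) := fun y => by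
    by_cases h : y = u ∨ y = v
    · tauto
    · exact Or.inr (Or.inr ⟨e.symm ⟨y, by simpa using h⟩, by simp⟩)
  obtain ⟨x, rfl⟩ : ∃ w, x = (e w : V) := by
    rcases hsurj x with h | h | h
    exacts [absurd h hxu, absurd h hxv, h]
  have hinj : Function.Injective (fun w => (e w : V)) :=
    Subtype.val_injective.comp e.injective
  refine ⟨fun w => e w, u, v, x, hinj, hsurj, fun w => (hmem w).1, fun w => (hmem w).2,
    ((hu' v).2 (Or.inr rfl)).ne, fun w w' => ?_, fun w => ?_, (hu' v).2 (Or.inr rfl),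
    fun w hw => (hmem w).1 ((hv' _).1 hw.symm)⟩
  · rw [← e.map_adj_iff]; rfl
  · rw [H.adj_comm, hu']
    exact ⟨fun h => h.elim (fun h => hinj h) (fun h => absurd h (hmem w).2),
      fun h => Or.inl (h ▸ rfl)⟩

/-- `E` dominates all vertices with the possible exception of `x`. -/
def IsDominatingSetExcept {W : Type*} (G : SimpleGraph W) (x : W) (E : Set W) : Prop :=
  ∀ w, w ≠ x → w ∉ E → ∃ d ∈ E, G.Adj w d

/-- The dominating sets that contain `x` and that, after removal of `x`, dominate all vertices
but `x`. -/
def criticalSets {W : Type*} (G : SimpleGraph W) (x : W) : Set {D : Set W // G.IsDominatingSet D} :=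
  {c | x ∈ c.1 ∧ ¬ G.IsDominatingSet (c.1 \ {x}) ∧ G.IsDominatingSetExcept x (c.1 \ {x})}

/-- The critical set is `E ∪ {x}`; here `x ∉ E`, since otherwise `E` would dominate everything. -/
theorem IsDominatingSetExcept.exists_mem_criticalSets {W : Type*} {G : SimpleGraph W} {x : W}
    {E : Set W} (h : G.IsDominatingSetExcept x E) (hE : ¬ G.IsDominatingSet E) :
    ∃ c ∈ G.criticalSets x, c.1 \ {x} = E := by
  have hx : x ∉ E := fun hx => hE fun w hw => h w (fun hwx => hw (hwx ▸ hx)) hw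
  have hdiff : (E ∪ {x}) \ {x} = E := by
    ext w
    by_cases hw : w = x <;> simp_all
  refine ⟨⟨E ∪ {x}, fun w hw => ?_⟩, ⟨by simp, ?_, ?_⟩, hdiff⟩
  · simp only [Set.mem_union, Set.mem_singleton_iff, not_or] at hw
    obtain ⟨d, hd, hwd⟩ := h w hw.2 hw.1
    exact ⟨d, Or.inl hd, hwd⟩
  · simpa only [hdiff] using hE
  · simpa only [hdiff] using h

/-- The set of vertices with trace `E` on the embedded graph and the given intersection with
`{u, v}`: `some true` stands for `{u, v}`, `some false` for `{u}`, and `none` for `{v}`. -/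
def pendantSet {V W : Type*} (j : W → V) (u v : V) (E : Set W) (k : Option Bool) : Set V :=
  {y | (∃ w ∈ E, j w = y) ∨ (y = u ∧ k ≠ none) ∨ (y = v ∧ k ≠ some false)}

namespace IsPendantPath

variable {V W : Type*} {H : SimpleGraph V} {H' : SimpleGraph W} {j : W → V} {u v : V} {x : W}
  (h : IsPendantPath H H' j u v x)
include h

theorem mem_pendantSet {E : Set W} {k : Option Bool} {w : W} :
    j w ∈ pendantSet j u v E k ↔ w ∈ E := by
  simp [pendantSet, h.ne_u, h.ne_v, h.injective.eq_iff]

theorem u_mem_pendantSet {E : Set W} {k : Option Bool} :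
    u ∈ pendantSet j u v E k ↔ k ≠ none := by
  simp [pendantSet, h.ne_u, h.u_ne_v]

theorem v_mem_pendantSet {E : Set W} {k : Option Bool} :
    v ∈ pendantSet j u v E k ↔ k ≠ some false := by
  simp [pendantSet, h.ne_v, h.u_ne_v.symm]

theorem set_ext {D D' : Set V} (hu : u ∈ D ↔ u ∈ D') (hv : v ∈ D ↔ v ∈ D')
    (hw : ∀ w, j w ∈ D ↔ j w ∈ D') : D = D' := by
  ext y
  rcases h.cases y with rfl | rfl | ⟨w, rfl⟩
  exacts [hu, hv, hw w]

theorem pendantSet_inj {E E' : Set W} {k k' : Option Bool} :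
    pendantSet j u v E k = pendantSet j u v E' k' ↔ E = E' ∧ k = k' := by
  refine ⟨fun heq => ⟨?_, ?_⟩, fun ⟨h1, h2⟩ => h1 ▸ h2 ▸ rfl⟩
  · ext w
    rw [← h.mem_pendantSet (E := E) (k := k), heq, h.mem_pendantSet]
  · have h1 := h.u_mem_pendantSet (E := E) (k := k)
    have h2 := h.v_mem_pendantSet (E := E) (k := k)
    rw [heq, h.u_mem_pendantSet] at h1
    rw [heq, h.v_mem_pendantSet] at h2
    rcases k with _ | _ | _ <;> rcases k' with _ | _ | _ <;> simp_all

theorem isDominatingSet_pendantSet {E : Set W} {k : Option Bool}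
    (hE : H'.IsDominatingSetExcept x E) (hk : k = none → H'.IsDominatingSet E) :
    H.IsDominatingSet (pendantSet j u v E k) := by
  intro y hy
  rcases h.cases y with rfl | rfl | ⟨w, rfl⟩
  · refine ⟨v, h.v_mem_pendantSet.2 fun hk' => ?_, h.adj_uv⟩
    exact hy (h.u_mem_pendantSet.2 (by simp [hk']))
  · refine ⟨u, h.u_mem_pendantSet.2 fun hk' => ?_, h.adj_uv.symm⟩
    exact hy (h.v_mem_pendantSet.2 (by simp [hk']))
  · rw [h.mem_pendantSet] at hy
    by_cases hw : w = x
    · by_cases hk' : k = none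
      · obtain ⟨d, hd, hwd⟩ := hk hk' w hy
        exact ⟨j d, h.mem_pendantSet.2 hd, (h.adj_iff _ _).2 hwd⟩
      · exact ⟨u, h.u_mem_pendantSet.2 hk', (h.adj_u w).2 hw⟩
    · obtain ⟨d, hd, hwd⟩ := hE w hw hy
      exact ⟨j d, h.mem_pendantSet.2 hd, (h.adj_iff _ _).2 hwd⟩

/-- Outside the trace, only `u` can dominate a vertex of `H'`, and only `x`. If `u ∉ D`, then `v ∈
D`, as nothing else dominates `v`, and the trace must dominate `x` as well. -/
theorem exists_eq_pendantSet {D : Set V} (hD : H.IsDominatingSet D) :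
    ∃ E k, D = pendantSet j u v E k ∧ H'.IsDominatingSetExcept x E ∧
      (k = none → H'.IsDominatingSet E) := by
  have key : ∀ w, j w ∉ D → (w ≠ x ∨ u ∉ D) → ∃ d ∈ j ⁻¹' D, H'.Adj w d := by
    intro w hw hor
    obtain ⟨d, hd, hwd⟩ := hD _ hw
    rcases h.cases d with rfl | rfl | ⟨d, rfl⟩
    · rw [h.adj_u] at hwd
      tauto
    · exact absurd hwd (h.not_adj_v w)
    · exact ⟨d, hd, (h.adj_iff _ _).1 hwd⟩
  have hexc : H'.IsDominatingSetExcept x (j ⁻¹' D) := fun w hwx hw => key w hw (Or.inl hwx)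
  by_cases hu : u ∈ D
  · by_cases hv : v ∈ D
    · refine ⟨j ⁻¹' D, some true,
        h.set_ext ?_ ?_ fun w => (h.mem_pendantSet (E := j ⁻¹' D)).symm, hexc, by simp⟩
      · simp [h.u_mem_pendantSet, hu]
      · simp [h.v_mem_pendantSet, hv]
    · refine ⟨j ⁻¹' D, some false,
        h.set_ext ?_ ?_ fun w => (h.mem_pendantSet (E := j ⁻¹' D)).symm, hexc, by simp⟩
      · simp [h.u_mem_pendantSet, hu]
      · simp [h.v_mem_pendantSet, hv]
  · have hv : v ∈ D := by
      by_contra hv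
      obtain ⟨d, hd, hvd⟩ := hD _ hv
      rcases h.cases d with rfl | rfl | ⟨d, rfl⟩
      exacts [hu hd, hv hd, h.not_adj_v d hvd.symm]
    refine ⟨j ⁻¹' D, none,
      h.set_ext ?_ ?_ fun w => (h.mem_pendantSet (E := j ⁻¹' D)).symm, hexc,
      fun _ w hw => key w hw (Or.inr hu)⟩
    · simp [h.u_mem_pendantSet, hu]
    · simp [h.v_mem_pendantSet, hv]

/-! ### Token moves realizing the edges of the expansion. -/

theorem tokenAddRemove_pendantSet {E E' : Set W} (k : Option Bool) (hE : TokenAddRemove E E') :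
    TokenAddRemove (pendantSet j u v E k) (pendantSet j u v E' k) := by
  have hu := fun w => (h.ne_u w).symm
  have hv := fun w => (h.ne_v w).symm
  rcases hE with ⟨w, hw, rfl⟩ | ⟨w, hw, rfl⟩
  · refine Or.inl ⟨j w, by rwa [h.mem_pendantSet], h.set_ext ?_ ?_ fun w' => ?_⟩ <;>
      simp [h.mem_pendantSet, h.u_mem_pendantSet, h.v_mem_pendantSet, hu, hv,
        h.injective.eq_iff]
  · refine Or.inr ⟨j w, by rwa [h.mem_pendantSet], h.set_ext ?_ ?_ fun w' => ?_⟩ <;>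
      simp [h.mem_pendantSet, h.u_mem_pendantSet, h.v_mem_pendantSet, hu, hv,
        h.injective.eq_iff]

theorem tokenSlide_pendantSet {E E' : Set W} (k : Option Bool) (hE : H'.TokenSlide E E') :
    H.TokenSlide (pendantSet j u v E k) (pendantSet j u v E' k) := by
  have hu := fun w => (h.ne_u w).symm
  have hv := fun w => (h.ne_v w).symm
  obtain ⟨a, b, ha, hb, hab, rfl⟩ := hE
  refine ⟨j a, j b, h.mem_pendantSet.2 ha, ⟨h.mem_pendantSet.2 hb.1,
    fun h' => hb.2 (h.mem_pendantSet.1 h')⟩, (h.adj_iff _ _).2 hab,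
    h.set_ext ?_ ?_ fun w' => ?_⟩ <;>
  simp [h.mem_pendantSet, h.u_mem_pendantSet, h.v_mem_pendantSet, hu, hv, h.injective.eq_iff]

theorem tokenAddRemove_remove_v (E : Set W) :
    TokenAddRemove (pendantSet j u v E (some true)) (pendantSet j u v E (some false)) := by
  refine Or.inr ⟨v, by simp [h.v_mem_pendantSet], h.set_ext ?_ ?_ fun w => ?_⟩ <;>
  simp [h.mem_pendantSet, h.u_mem_pendantSet, h.v_mem_pendantSet, h.u_ne_v, h.ne_v]

theorem tokenAddRemove_remove_u (E : Set W) :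
    TokenAddRemove (pendantSet j u v E (some true)) (pendantSet j u v E none) := by
  refine Or.inr ⟨u, by simp [h.u_mem_pendantSet], h.set_ext ?_ ?_ fun w => ?_⟩ <;>
  simp [h.mem_pendantSet, h.u_mem_pendantSet, h.v_mem_pendantSet, h.u_ne_v.symm, h.ne_u]

theorem tokenSlide_u_v (E : Set W) :
    H.TokenSlide (pendantSet j u v E (some false)) (pendantSet j u v E none) := by
  refine ⟨u, v, by simp [h.u_mem_pendantSet], by simp [h.v_mem_pendantSet], h.adj_uv,
    h.set_ext ?_ ?_ fun w => ?_⟩ <;>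
  simp [h.mem_pendantSet, h.u_mem_pendantSet, h.v_mem_pendantSet, h.u_ne_v.symm, h.ne_u, h.ne_v]

/-- This slide along the edge `ux` supplies `outer_top`, the edge that makes odd excesses possible.
-/
theorem tokenSlide_u_x {E : Set W} (hE : x ∈ E) :
    H.TokenSlide (pendantSet j u v (E \ {x}) (some true)) (pendantSet j u v E none) := by
  refine ⟨u, j x, by simp [h.u_mem_pendantSet], by simp [h.mem_pendantSet, hE],
    ((h.adj_u x).2 rfl).symm, h.set_ext ?_ ?_ fun w => ?_⟩
  · simp [h.u_mem_pendantSet]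
  · simp [h.v_mem_pendantSet, h.u_ne_v.symm]
  · by_cases hw : w = x <;> simp [h.mem_pendantSet, h.ne_u, h.injective.eq_iff, hw, hE]

/-- The dominating sets of `H`, indexed by the expansion of the TARS-graph of `H'`. -/
def toDominatingSet : Expansion (H'.criticalSets x) → {D : Set V // H.IsDominatingSet D}
  | .inl (c, k) => ⟨pendantSet j u v c.1 k,
      h.isDominatingSet_pendantSet (fun w _ hw => c.2 w hw) fun _ => c.2⟩
  | .inr (c, s) => ⟨pendantSet j u v (c.1.1 \ {x}) (some s),
      h.isDominatingSet_pendantSet c.2.2.2 (by simp)⟩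

/-- The two summands have disjoint images because their traces are dominating and non-dominating,
respectively; a critical set is recovered from its trace by putting `x` back. -/
theorem toDominatingSet_bijective : Function.Bijective h.toDominatingSet := by
  constructor
  · rintro (⟨c, k⟩ | ⟨c, s⟩) (⟨c', k'⟩ | ⟨c', s'⟩) heq <;>
      replace heq := h.pendantSet_inj.1 (congrArg Subtype.val heq)
    · obtain ⟨h1, rfl⟩ := heq
      rw [Subtype.ext h1]
    · exact absurd (heq.1 ▸ c.2) c'.2.2.1
    · exact absurd (heq.1.symm ▸ c'.2) c.2.2.1
    · obtain ⟨h1, h2⟩ := heq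
      have : c.1.1 = c'.1.1 := by
        rw [← Set.sdiff_union_of_subset (Set.singleton_subset_iff.2 c.2.1), h1,
          Set.sdiff_union_of_subset (Set.singleton_subset_iff.2 c'.2.1)]
      rw [Subtype.ext (Subtype.ext this), Option.some.inj h2]
  · rintro ⟨D, hD⟩
    obtain ⟨E, k, rfl, hE, hk⟩ := h.exists_eq_pendantSet hD
    by_cases hdom : H'.IsDominatingSet E
    · exact ⟨.inl (⟨E, hdom⟩, k), rfl⟩
    · obtain ⟨c, hc, rfl⟩ := hE.exists_mem_criticalSets hdom
      obtain ⟨s, rfl⟩ := Option.ne_none_iff_exists'.1 fun h => hdom (hk h)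
      exact ⟨.inr (⟨c, hc⟩, s), rfl⟩

theorem isExpansion :
    IsExpansion H'.tarsGraph (H'.criticalSets x) (H.tarsGraph.comap h.toDominatingSet) where
  rung c s := by
    cases s
    · exact Or.inl (h.tokenAddRemove_remove_v _).symm
    · exact Or.inl (h.tokenAddRemove_remove_v _)
  layer k c c' hcc := hcc.imp (h.tokenAddRemove_pendantSet k) (h.tokenSlide_pendantSet k)
  top c s := by
    cases s
    · exact Or.inr (h.tokenSlide_u_v _)
    · exact Or.inl (h.tokenAddRemove_remove_u _)
  outer_rung c s := by
    cases s
    · exact Or.inl (h.tokenAddRemove_remove_v _).symm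
    · exact Or.inl (h.tokenAddRemove_remove_v _)
  outer c s := Or.inl (h.tokenAddRemove_pendantSet _ (Or.inr ⟨x, c.2.1, rfl⟩))
  outer_top c := Or.inr (h.tokenSlide_u_x c.2.1)

end IsPendantPath

/-! ### Conclusion. -/

/-- A connected graph on at least two vertices has at least three dominating sets. -/
theorem Connected.three_le_card_dominatingSet {W : Type*} [Finite W] {G : SimpleGraph W}
    (hG : G.Connected) (hcard : 2 ≤ Nat.card W) :
    3 ≤ Nat.card {D : Set W // G.IsDominatingSet D} := by
  classical
  have : Nontrivial W := Finite.one_lt_card_iff_nontrivial.1 hcard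
  have := Fintype.ofFinite {D : Set W // G.IsDominatingSet D}
  have hdom : ∀ w : W, G.IsDominatingSet {w}ᶜ := by
    intro w y hy
    obtain rfl : y = w := by simpa using hy
    obtain ⟨d, hd⟩ := hG.preconnected.exists_adj_of_nontrivial y
    exact ⟨d, by simpa using hd.ne', hd⟩
  obtain ⟨a, b, hab⟩ := exists_pair_ne W
  rw [Nat.card_eq_fintype_card]
  refine Nat.succ_le_of_lt (Fintype.two_lt_card_iff.2
    ⟨⟨Set.univ, by simp [IsDominatingSet]⟩, ⟨_, hdom a⟩, ⟨_, hdom b⟩, ?_, ?_, ?_⟩)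
  · exact fun h => by simpa using (congrArg Subtype.val h).le (Set.mem_univ a)
  · exact fun h => by simpa using (congrArg Subtype.val h).le (Set.mem_univ b)
  · simpa using hab

end SimpleGraph

theorem mainTheorem3 {V W : Type*} [Finite V] [Finite W]
    (H : SimpleGraph V) (H' : SimpleGraph W)
    (hconn : H'.Connected) (hcard : 2 ≤ Nat.card W)
    (hop : H.IsOperationA H')
    (hpan : H'.tarsGraph.IsPancyclic) :
    H.tarsGraph.IsPancyclic := by
  obtain ⟨j, u, v, x, h⟩ := hop.exists_isPendantPath
  -- Pancyclicity is applied at the maximal length, which is at least 3, to get a Hamiltonian cycle.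
  obtain ⟨a, p, hp, hlen⟩ := hpan _ (hconn.three_le_card_dominatingSet hcard) le_rfl
  exact (h.isExpansion.isPancyclic hp hlen).of_bijective
    (SimpleGraph.Hom.comap h.toDominatingSet _) h.toDominatingSet_bijective
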